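/- Let $\alpha\in(0,1)$, $\mu>0$, $\sigma>0$ and $d\ge 1$. A stochastic first-order problem on $\mathbb{R}^d$ is a pair $(f,\Phi)$ of an objective $f:\mathbb{R}^d\to\mathbb{R}$ and an oracle $\Phi$, which consists of a noise distribution $\Pr_\Phi$ and a gradient function $g$; the $k$-th oracle call, made at $x_k$, returns $g(x_k,\xi_k)$, where $\xi_1,\xi_2,\dots$ are i.i.d. with law $\Pr_\Phi$. A stochastic gradient method $\mathcal M$ selects the query points $x_1,x_2,\dots\in\mathbb{R}^d$, where $x_{k+1}$ is a function of $k$, of the answers $g(x_1,\xi_1),\dots,g(x_k,\xi_k)$, and possibly of an internal random seed independent of the noise. Let $\Psi_{sc}(\mu,\sigma)$ be the class of problems such that $f$ is differentiable and $\mu$-strongly convex, and for every $x$ and $k$, $\mathbb{E}[g(x,\xi_k)]=\nabla f(x)$ and $\mathbb{E}\big[\exp\big(\|g(x,\xi_k)-\nabla f(x)\|^2/\sigma^2\big)\big]\le \exp(1)$. For $L\in[\mu,\infty]$, $D\in(0,\infty]$ and $c\in\mathbb{R}^d$, let $\Psi_{sc}(\mu,\sigma;L,D,c)$ be the class of those $(f,\Phi)\in\Psi_{sc}(\mu,\sigma)$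 for which $\nabla f$ is $L$-Lipschitz and the minimizer of $f$ lies within distance $D$ of $c$; for $L=D=\infty$ this is $\Psi_{sc}(\mu,\sigma)$ itself. Suppose that for some such $L$, $D$, $c$ the method $\mathcal M$ has uniform-in-time convergence rate $\varepsilon:\mathbb{N}_+\to[0,\infty)$ on $\Psi_{sc}(\mu,\sigma;L,D,c)$ with confidence $1-\alpha$, i.e. for every $(f,\Phi)$ in this class, with $f^*=\inf f$, $$\Pr\big(f(x_k)-f^*\le\varepsilon(k)\ \text{ for all } k\in\mathbb{N}_+\big)\ge 1-\alpha .$$ Then for infinitely many $n\in\mathbb{N}_+$, $$\varepsilon(n)\ \ge\ \frac{\sigma^2(1-\alpha)}{48\,\mu}\cdot\frac{\log\log n}{n}.$$ -/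

import Mathlib

open MeasureTheory
open scoped ENNReal NNReal

universe u

/-- The space `ℝ^d` with its Euclidean norm. -/
abbrev Vec (d : ℕ) : Type := EuclideanSpace ℝ (Fin d)

/-- A stochastic first-order oracle on `ℝ^d`: a noise distribution `law` on a measurable space
`Noise`, and a gradient function `g`. Called at `x` with noise `ξ` it reveals `g x ξ`. -/
structure Oracle (d : ℕ) where
  Noise : Type
  [measurableSpace : MeasurableSpace Noise]
  law : Measure Noise
  [isProbabilityMeasure : IsProbabilityMeasure law]
  g : Vec d → Noise → Vec d
  measurable_g : Measurable (Function.uncurry g)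

attribute [instance] Oracle.measurableSpace Oracle.isProbabilityMeasure

/-- A stochastic first-order method on `ℝ^d`, possibly with internal randomness (a seed drawn once
from `seedLaw`, independent of the oracle noise). From the seed and the first `k` oracle answers
it decides the `(k+1)`-st query point `query k`. A deterministic method ignores the seed. -/
structure StochasticMethod (d : ℕ) where
  Seed : Type u
  [measurableSpace : MeasurableSpace Seed]
  seedLaw : Measure Seed
  [isProbabilityMeasure : IsProbabilityMeasure seedLaw]
  query : (k : ℕ) → Seed → (Fin k → Vec d) → Vec d
  measurable_query : ∀ k, Measurable (Function.uncurry (query k))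

attribute [instance] StochasticMethod.measurableSpace StochasticMethod.isProbabilityMeasure

namespace StochasticMethod

variable {d : ℕ}

/-- The first `k` oracle answers, when the method runs with seed `ω` and noise sequence
`ξ 0, ξ 1, …` (`ξ i` is the noise of the `(i+1)`-st call). -/
def answers (M : StochasticMethod.{u} d) (Φ : Oracle d) (ω : M.Seed) (ξ : ℕ → Φ.Noise) :
    (k : ℕ) → Fin k → Vec d
  | 0 => Fin.elim0
  | k + 1 =>
      Fin.snoc (α := fun _ => Vec d) (answers M Φ ω ξ k)
        (Φ.g (M.query k ω (answers M Φ ω ξ k)) (ξ k))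

/-- The query point `x_k`, `k = 1, 2, …`; it is decided from the first `k - 1` answers. -/
def iterate (M : StochasticMethod.{u} d) (Φ : Oracle d) (ω : M.Seed) (ξ : ℕ → Φ.Noise)
    (k : ℕ+) : Vec d :=
  M.query k.natPred ω (M.answers Φ ω ξ k.natPred)

/-- The joint law of the seed and of the i.i.d. noise sequence of the oracle. -/
noncomputable def runLaw (M : StochasticMethod.{u} d) (Φ : Oracle d) :
    Measure (M.Seed × (ℕ → Φ.Noise)) :=
  M.seedLaw.prod (Measure.infinitePi fun _ : ℕ => Φ.law)

end StochasticMethod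

/-- The class `Ψ_sc(μ, σ)`: `f` is differentiable and `μ`-strongly convex, and the oracle answers
are unbiased for the gradient with `σ`-sub-Gaussian noise. -/
structure IsStronglyConvexProblem {d : ℕ} (μ σ : ℝ) (f : Vec d → ℝ) (Φ : Oracle d) : Prop where
  differentiable : Differentiable ℝ f
  strongConvex : StrongConvexOn Set.univ μ f
  integrable : ∀ x, Integrable (Φ.g x) Φ.law
  unbiased : ∀ x, ∫ ξ, Φ.g x ξ ∂Φ.law = gradient f x
  subGaussian : ∀ x,
    ∫⁻ ξ, ENNReal.ofReal (Real.exp (‖Φ.g x ξ - gradient f x‖ ^ 2 / σ ^ 2)) ∂Φ.law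
      ≤ ENNReal.ofReal (Real.exp 1)

/-- The class `Ψ_sc(μ, σ)` with, in addition, an `L`-Lipschitz gradient and the minimizer within
distance `D` of the reference point `c`. For `L = ⊤` and `D = ⊤` the two additional conditions
hold trivially and this is all of `Ψ_sc(μ, σ)`. -/
structure IsStronglyConvexProblemWithin {d : ℕ} (μ σ : ℝ) (L D : ℝ≥0∞) (c : Vec d)
    (f : Vec d → ℝ) (Φ : Oracle d) : Prop where
  isStronglyConvexProblem : IsStronglyConvexProblem μ σ f Φ
  smooth : ∀ x y, edist (gradient f x) (gradient f y) ≤ L * edist x y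
  minimizer_mem : ∀ x, IsMinOn f Set.univ x → edist x c ≤ D

/-- The method `M` has uniform-in-time convergence rate `ε` with confidence `1 - α` on a class
`Ψ` of problems `(f, Φ)`. -/
def HasUniformRate {d : ℕ} (M : StochasticMethod.{u} d) (Ψ : (Vec d → ℝ) → Oracle d → Prop)
    (ε : ℕ+ → ℝ≥0) (α : ℝ) : Prop :=
  ∀ (f : Vec d → ℝ) (Φ : Oracle d), Ψ f Φ →
    ENNReal.ofReal (1 - α) ≤
      M.runLaw Φ {p | ∀ k : ℕ+, f (M.iterate Φ p.1 p.2 k) - (⨅ x, f x) ≤ (ε k : ℝ)}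

/-! ### Causality and measurability of the iterates -/

namespace StochasticMethod

variable {d : ℕ}

/-! All hard problems are quadratics whose oracles answer by the same function of query point and
coin toss; only the coin's bias `θ` differs, and it shifts the minimizer along `e` by an amount
proportional to `θ`. So the iterates are one fixed function of seed and tosses
(`iterate_coinOracle`). Suppose the bound fails for all large `n`. Take biases `lilBias j` at times
`128 ^ j`, and let `G j` be the event that the method succeeds on problem `j` at the times `128 ^
i`, `j₀ ≤ i ≤ j`. It has probability at least `1 - α` under bias `lilBias j`, so a second-moment
change of measure (`le_coinRunLaw_zero`) gives it fair-coin probability at least `(1 - α) ^ 2 / (j *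
log 128)`. The events are disjoint: for `i < j`, no point at time `128 ^ i` is accurate enough for
both problems (`sq_dist_minimizers_le`). Since the harmonic series diverges, the total fair-coin
probability would exceed 1. -/

theorem answers_congr (M : StochasticMethod.{u} d) (Φ : Oracle d) (ω : M.Seed)
    {ξ ξ' : ℕ → Φ.Noise} (k : ℕ) (h : ∀ i < k, ξ i = ξ' i) :
    M.answers Φ ω ξ k = M.answers Φ ω ξ' k := by
  induction k with
  | zero => rfl
  | succ k ih =>
    simp only [answers]
    rw [ih fun i hi => h i (hi.trans k.lt_succ_self), h k k.lt_succ_self]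

theorem iterate_congr (M : StochasticMethod.{u} d) (Φ : Oracle d) (ω : M.Seed)
    {ξ ξ' : ℕ → Φ.Noise} (k : ℕ+) (h : ∀ i < (k : ℕ), ξ i = ξ' i) :
    M.iterate Φ ω ξ k = M.iterate Φ ω ξ' k := by
  unfold iterate
  rw [M.answers_congr Φ ω k.natPred fun i hi => h i (hi.trans (Nat.pred_lt k.ne_zero))]

theorem measurable_answers (M : StochasticMethod.{u} d) (Φ : Oracle d) (k : ℕ) :
    Measurable fun p : M.Seed × (ℕ → Φ.Noise) => M.answers Φ p.1 p.2 k := by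
  induction k with
  | zero => exact measurable_pi_iff.2 fun i => i.elim0
  | succ k ih =>
    refine measurable_pi_iff.2 fun i => ?_
    simp only [answers]
    induction i using Fin.lastCases with
    | last =>
      simp only [Fin.snoc_last]
      exact Φ.measurable_g.comp
        (((M.measurable_query k).comp (measurable_fst.prodMk ih)).prodMk
          ((measurable_pi_apply k).comp measurable_snd))
    | cast i =>
      simp only [Fin.snoc_castSucc]
      exact (measurable_pi_apply i).comp ih

theorem measurable_iterate (M : StochasticMethod.{u} d) (Φ : Oracle d) (k : ℕ+) :
    Measurable fun p : M.Seed × (ℕ → Φ.Noise) => M.iterate Φ p.1 p.2 k :=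
  (M.measurable_query k.natPred).comp (measurable_fst.prodMk (M.measurable_answers Φ k.natPred))

end StochasticMethod

/-! ### Biased against fair coins -/

/-- The law of a coin with values `true`, `false` and bias `θ`. -/
noncomputable def coinLaw (θ : ℝ) : Measure Bool :=
  ENNReal.ofReal ((1 + θ) / 2) • Measure.dirac true +
    ENNReal.ofReal ((1 - θ) / 2) • Measure.dirac false

/-- The probability that a coin of bias `θ` shows `s`. -/
noncomputable def coinWeight (θ : ℝ) (s : Bool) : ℝ := bif s then (1 + θ) / 2 else (1 - θ) / 2

theorem coinWeight_nonneg {θ : ℝ} (hθ : |θ| ≤ 1) (s : Bool) : 0 ≤ coinWeight θ s := by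
  obtain ⟨h₁, h₂⟩ := abs_le.1 hθ
  cases s <;> simp only [coinWeight, cond_true, cond_false] <;> linarith

theorem coinLaw_singleton (θ : ℝ) (s : Bool) :
    coinLaw θ {s} = ENNReal.ofReal (coinWeight θ s) := by
  cases s <;> simp [coinLaw, coinWeight]

theorem isProbabilityMeasure_coinLaw {θ : ℝ} (hθ : |θ| ≤ 1) :
    IsProbabilityMeasure (coinLaw θ) := by
  obtain ⟨h₁, h₂⟩ := abs_le.1 hθ
  refine ⟨?_⟩
  simp only [coinLaw, Measure.add_apply, Measure.smul_apply, measure_univ, smul_eq_mul, mul_one]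
  rw [← ENNReal.ofReal_add (by linarith) (by linarith), ← ENNReal.ofReal_one]
  congr 1
  ring

theorem integral_coinLaw {E : Type*} [NormedAddCommGroup E] [NormedSpace ℝ E] [CompleteSpace E]
    {θ : ℝ} (hθ : |θ| ≤ 1) (φ : Bool → E) :
    ∫ s, φ s ∂coinLaw θ = ((1 + θ) / 2) • φ true + ((1 - θ) / 2) • φ false := by
  have := isProbabilityMeasure_coinLaw hθ
  obtain ⟨h₁, h₂⟩ := abs_le.1 hθ
  rw [integral_fintype Integrable.of_finite, Fintype.sum_bool]
  simp only [Measure.real, coinLaw_singleton, ENNReal.toReal_ofReal (coinWeight_nonneg hθ _)]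
  rfl

theorem pi_coinLaw_apply {ι : Type*} [Fintype ι] [DecidableEq ι] {θ : ℝ} (hθ : |θ| ≤ 1) (T : Set (ι → Bool)) :
    Measure.pi (fun _ : ι => coinLaw θ) T =
      ENNReal.ofReal (∑ s, T.indicator (fun s => ∏ i, coinWeight θ (s i)) s) := by
  classical
  have := isProbabilityMeasure_coinLaw hθ
  have h0 : ∀ s : ι → Bool, 0 ≤ ∏ i, coinWeight θ (s i) := fun s =>
    Finset.prod_nonneg fun i _ => coinWeight_nonneg hθ _
  rw [ENNReal.ofReal_sum_of_nonneg fun s _ => Set.indicator_nonneg (fun s _ => h0 s) s,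
    ← lintegral_indicator_one T.toFinite.measurableSet, lintegral_fintype]
  refine Finset.sum_congr rfl fun s _ => ?_
  rw [Measure.pi_singleton]
  by_cases hs : s ∈ T
  · simp only [hs, Set.indicator_of_mem, Pi.one_apply, one_mul, coinLaw_singleton]
    rw [ENNReal.ofReal_prod_of_nonneg fun i _ => coinWeight_nonneg hθ _]
  · simp [hs]

/-- Second moment, under the fair coin, of the likelihood ratio; each toss contributes the factor `1
+ θ ^ 2`. -/
theorem sum_prod_coinWeight_sq {ι : Type*} [Fintype ι] [DecidableEq ι] (θ : ℝ) :
    ∑ s : ι → Bool, ∏ i, (2 * coinWeight θ (s i) ^ 2) = (1 + θ ^ 2) ^ Fintype.card ι := by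
  classical
  have h := Finset.prod_univ_sum (fun _ : ι => (Finset.univ : Finset Bool))
    (fun _ b => 2 * coinWeight θ b ^ 2)
  rw [Fintype.piFinset_univ] at h
  rw [← h]
  rw [Finset.prod_const, Finset.card_univ]
  congr 1
  rw [Fintype.sum_bool]
  simp only [coinWeight, cond_true, cond_false]
  ring

/-- Comparison of the laws of finitely many tosses of a biased and of a fair coin, from the
second moment of the likelihood ratio. -/
theorem pi_coinLaw_le {ι : Type*} [Fintype ι] [DecidableEq ι] {θ : ℝ} (hθ : |θ| ≤ 1) {t : ℝ} (ht : 0 < t)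
    (T : Set (ι → Bool)) :
    Measure.pi (fun _ : ι => coinLaw θ) T ≤
      ENNReal.ofReal ((1 + θ ^ 2) ^ Fintype.card ι / (2 * t)) +
        ENNReal.ofReal (t / 2) * Measure.pi (fun _ : ι => coinLaw 0) T := by
  classical
  have h0 : ∀ s : ι → Bool, 0 ≤ ∏ i, coinWeight 0 (s i) := fun s =>
    Finset.prod_nonneg fun i _ => coinWeight_nonneg (by simp) _
  rw [pi_coinLaw_apply hθ, pi_coinLaw_apply (by simp), ← ENNReal.ofReal_mul (by positivity),
    ← ENNReal.ofReal_add (by positivity) (mul_nonneg (by positivity)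
      (Finset.sum_nonneg fun s _ => Set.indicator_nonneg (fun s _ => h0 s) s))]
  refine ENNReal.ofReal_le_ofReal ?_
  rw [← sum_prod_coinWeight_sq θ, Finset.sum_div, Finset.mul_sum, ← Finset.sum_add_distrib]
  refine Finset.sum_le_sum fun s _ => ?_
  have e1 : ∏ i, (2 * coinWeight θ (s i) ^ 2) =
      2 ^ Fintype.card ι * (∏ i, coinWeight θ (s i)) ^ 2 := by
    rw [Finset.prod_mul_distrib, Finset.prod_const, Finset.card_univ, Finset.prod_pow]
  have e2 : ∏ i, coinWeight 0 (s i) = ((2 : ℝ) ^ Fintype.card ι)⁻¹ := by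
    have : ∀ b, coinWeight 0 b = 2⁻¹ := by intro b; cases b <;> simp [coinWeight]
    simp [this]
  set w := ∏ i, coinWeight θ (s i)
  have hA : (0 : ℝ) < 2 ^ Fintype.card ι := by positivity
  rw [e1]
  by_cases hs : s ∈ T
  · simp only [hs, Set.indicator_of_mem, e2]
    set A := (2 : ℝ) ^ Fintype.card ι
    -- `A * w` is the likelihood ratio `R`; this is `R ≤ R ^ 2 / (2 * t) + t / 2` divided by `A`.
    have key : A * w ^ 2 / (2 * t) + t / 2 * A⁻¹ - w = (A * w - t) ^ 2 / (2 * t * A) := by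
      field_simp
      ring
    have : 0 ≤ (A * w - t) ^ 2 / (2 * t * A) := by positivity
    linarith
  · simp only [hs, not_false_eq_true, Set.indicator_of_notMem, mul_zero, add_zero]
    positivity

theorem infinitePi_coinLaw_le {θ : ℝ} (hθ : |θ| ≤ 1) {t : ℝ} (ht : 0 < t) {n : ℕ}
    {S : Set (ℕ → Bool)} (hS : ∀ ξ ξ' : ℕ → Bool, (∀ i < n, ξ i = ξ' i) → ξ ∈ S → ξ' ∈ S) :
    Measure.infinitePi (fun _ : ℕ => coinLaw θ) S ≤
      ENNReal.ofReal ((1 + θ ^ 2) ^ n / (2 * t)) +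
        ENNReal.ofReal (t / 2) * Measure.infinitePi (fun _ : ℕ => coinLaw 0) S := by
  classical
  -- The padding value `true` is immaterial, as `S` is decided by the first `n` tosses.
  let T : Set (Finset.range n → Bool) :=
    {s | (fun i => if h : i ∈ Finset.range n then s ⟨i, h⟩ else true) ∈ S}
  have hST : S = (Finset.range n).restrict ⁻¹' T := by
    ext ξ
    constructor
    · exact hS _ _ fun i hi => by simp [hi]
    · exact hS _ _ fun i hi => by simp [hi]
  have key : ∀ {η : ℝ}, |η| ≤ 1 → Measure.infinitePi (fun _ : ℕ => coinLaw η) S =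
      Measure.pi (fun _ : Finset.range n => coinLaw η) T := by
    intro η hη
    have := isProbabilityMeasure_coinLaw hη
    rw [← Measure.infinitePi_map_restrict (fun _ : ℕ => coinLaw η),
      Measure.map_apply (Finset.measurable_restrict _) T.toFinite.measurableSet, ← hST]
  rw [key hθ, key (by simp)]
  simpa using pi_coinLaw_le hθ ht T

/-! ### The hard problems -/

/-- The sign of a coin toss. -/
def coinSign (s : Bool) : ℝ := bif s then 1 else -1

/-- The oracle of the quadratic `x ↦ μ / 2 * ‖x - (c + (b * θ / μ) • e)‖ ^ 2` whose noise is a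
coin of bias `θ`, acting in direction `e`. -/
noncomputable def coinOracle {d : ℕ} (μ b : ℝ) (c e : Vec d) (θ : ℝ) (hθ : |θ| ≤ 1) :
    Oracle d where
  Noise := Bool
  law := coinLaw θ
  isProbabilityMeasure := isProbabilityMeasure_coinLaw hθ
  -- The bias `θ` does not occur here: it enters only through `law`.
  g x s := μ • (x - c) - (b * coinSign s) • e
  measurable_g := by
    have h : Measurable coinSign := Measurable.of_discrete
    unfold Function.uncurry
    fun_prop

/-- The objective `x ↦ μ / 2 * ‖x - p‖ ^ 2`. -/
noncomputable def quadratic {d : ℕ} (μ : ℝ) (p : Vec d) (x : Vec d) : ℝ := μ / 2 * ‖x - p‖ ^ 2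

section quadratic

variable {d : ℕ} {μ : ℝ} (p : Vec d)

theorem hasGradientAt_quadratic (x : Vec d) :
    HasGradientAt (quadratic μ p) (μ • (x - p)) x := by
  have h := (((hasStrictFDerivAt_norm_sq (x - p)).hasFDerivAt.comp x
    ((hasFDerivAt_id x).sub_const p)).const_mul (μ / 2))
  rw [hasGradientAt_iff_hasFDerivAt]
  refine h.congr_fderiv ?_
  ext y
  simp
  ring

theorem gradient_quadratic (x : Vec d) : gradient (quadratic μ p) x = μ • (x - p) :=
  (hasGradientAt_quadratic p x).gradient

theorem quadratic_nonneg (hμ : 0 ≤ μ) (x : Vec d) : 0 ≤ quadratic μ p x := by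
  unfold quadratic
  positivity

theorem quadratic_self : quadratic μ p p = 0 := by simp [quadratic]

theorem iInf_quadratic (hμ : 0 ≤ μ) : ⨅ x, quadratic μ p x = 0 :=
  le_antisymm ((ciInf_le ⟨0, Set.forall_mem_range.2 (quadratic_nonneg p hμ)⟩ p).trans_eq
    (quadratic_self p)) (le_ciInf (quadratic_nonneg p hμ))

theorem eq_of_isMinOn_quadratic (hμ : 0 < μ) {x : Vec d}
    (h : IsMinOn (quadratic μ p) Set.univ x) : x = p := by
  have h1 : quadratic μ p x ≤ 0 := (h (Set.mem_univ p)).trans_eq (quadratic_self p)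
  have h2 : ‖x - p‖ ^ 2 = 0 := by
    have : 0 ≤ ‖x - p‖ ^ 2 := by positivity
    unfold quadratic at h1
    nlinarith
  simpa [sub_eq_zero] using h2

theorem strongConvexOn_quadratic : StrongConvexOn Set.univ μ (quadratic μ p) := by
  rw [strongConvexOn_iff_convex]
  have h : (fun x : Vec d => quadratic μ p x - μ / 2 * ‖x‖ ^ 2) =
      fun x => (-μ • innerSL ℝ p) x + μ / 2 * ‖p‖ ^ 2 := by
    ext x
    simp only [quadratic, norm_sub_sq_real, smul_apply, innerSL_apply_apply,
      smul_eq_mul, real_inner_comm]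
    ring
  rw [h]
  exact (((-μ • innerSL ℝ p).toLinearMap).convexOn convex_univ).add_const _

end quadratic

/-- The noise is `b * (θ - coinSign s)` times a unit vector, so its norm is at most `2 * b ≤ σ` and
the sub-Gaussian bound holds pointwise. -/
theorem isStronglyConvexProblemWithin_quadratic {d : ℕ} {μ σ b θ : ℝ} (hμ : 0 < μ) (hσ : 0 < σ)
    (hb : 0 ≤ b) (hθ : |θ| ≤ 1) (hbσ : 2 * b ≤ σ) {L D : ℝ≥0∞} (hL : ENNReal.ofReal μ ≤ L)
    (c : Vec d) {e : Vec d} (he : ‖e‖ = 1) (hD : ENNReal.ofReal (b * |θ| / μ) ≤ D) :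
    IsStronglyConvexProblemWithin μ σ L D c (quadratic μ (c + (b * θ / μ) • e))
      (coinOracle μ b c e θ hθ) where
  isStronglyConvexProblem :=
    { differentiable := fun x => (hasGradientAt_quadratic _ x).differentiableAt
      strongConvex := strongConvexOn_quadratic _
      integrable := fun x => by
        have := isProbabilityMeasure_coinLaw hθ
        exact Integrable.of_finite (μ := coinLaw θ)
      unbiased := fun x => by
        rw [gradient_quadratic]
        refine (integral_coinLaw hθ _).trans ?_
        simp only [coinOracle, coinSign, cond_true, cond_false]
        rw [← sub_sub, smul_sub μ (x - c), smul_smul, mul_div_cancel₀ _ hμ.ne']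
        module
      subGaussian := fun x => by
        have := isProbabilityMeasure_coinLaw hθ
        have key : ∀ s : Bool, ‖(coinOracle μ b c e θ hθ).g x s -
            gradient (quadratic μ (c + (b * θ / μ) • e)) x‖ ^ 2 / σ ^ 2 ≤ 1 := by
          intro s
          have h1 : (coinOracle μ b c e θ hθ).g x s -
              gradient (quadratic μ (c + (b * θ / μ) • e)) x = (b * (θ - coinSign s)) • e := by
            rw [gradient_quadratic, ← sub_sub, smul_sub μ (x - c), smul_smul,
              mul_div_cancel₀ _ hμ.ne']
            simp only [coinOracle]
            module
          have h2 : |θ - coinSign s| ≤ 2 := by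
            obtain ⟨h₁, h₂⟩ := abs_le.1 hθ
            rw [abs_le]
            cases s <;> simp only [coinSign, cond_true, cond_false] <;> constructor <;> linarith
          rw [h1, norm_smul, he, mul_one, Real.norm_eq_abs, abs_mul, abs_of_nonneg hb,
            div_le_one (by positivity)]
          have : b * |θ - coinSign s| ≤ σ := by nlinarith
          gcongr
        have h : ∫⁻ _ : Bool, ENNReal.ofReal (Real.exp 1) ∂coinLaw θ =
            ENNReal.ofReal (Real.exp 1) := by
          rw [lintegral_const, measure_univ, mul_one]
        exact (lintegral_mono fun s => ENNReal.ofReal_le_ofReal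
          (Real.exp_le_exp.2 (key s))).trans_eq h }
  smooth x y := by
    rw [gradient_quadratic, gradient_quadratic, edist_eq_enorm_sub, edist_eq_enorm_sub,
      ← smul_sub, sub_sub_sub_cancel_right, enorm_smul, Real.enorm_eq_ofReal hμ.le]
    gcongr
  minimizer_mem x hx := by
    rw [eq_of_isMinOn_quadratic _ hμ hx, edist_eq_enorm_sub, add_sub_cancel_left,
      ← ofReal_norm, norm_smul, he, mul_one, Real.norm_eq_abs, abs_div, abs_mul,
      abs_of_nonneg hb, abs_of_pos hμ]
    exact hD

/-! ### Change of measure for runs of the method -/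

namespace StochasticMethod

variable {d : ℕ}

theorem answers_coinOracle (M : StochasticMethod.{u} d) (μ b : ℝ) (c e : Vec d) {θ θ' : ℝ}
    (hθ : |θ| ≤ 1) (hθ' : |θ'| ≤ 1) (ω : M.Seed) (ξ : ℕ → Bool) (k : ℕ) :
    M.answers (coinOracle μ b c e θ hθ) ω ξ k = M.answers (coinOracle μ b c e θ' hθ') ω ξ k := by
  induction k with
  | zero => rfl
  | succ k ih =>
    simp only [answers]
    rw [ih]
    rfl

theorem iterate_coinOracle (M : StochasticMethod.{u} d) (μ b : ℝ) (c e : Vec d) {θ θ' : ℝ}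
    (hθ : |θ| ≤ 1) (hθ' : |θ'| ≤ 1) (ω : M.Seed) (ξ : ℕ → Bool) (k : ℕ+) :
    M.iterate (coinOracle μ b c e θ hθ) ω ξ k = M.iterate (coinOracle μ b c e θ' hθ') ω ξ k := by
  unfold iterate
  rw [M.answers_coinOracle μ b c e hθ hθ']

/-- The joint law of the seed and of the tosses of a coin of bias `θ`. -/
noncomputable def coinRunLaw (M : StochasticMethod.{u} d) (θ : ℝ) :
    Measure (M.Seed × (ℕ → Bool)) :=
  M.seedLaw.prod (Measure.infinitePi fun _ : ℕ => coinLaw θ)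

theorem isProbabilityMeasure_coinRunLaw (M : StochasticMethod.{u} d) {θ : ℝ} (hθ : |θ| ≤ 1) :
    IsProbabilityMeasure (M.coinRunLaw θ) := by
  have := isProbabilityMeasure_coinLaw hθ
  unfold coinRunLaw
  infer_instance

/-- The seed has the same law for both biases, so the bound for each fixed seed can be integrated.
-/
theorem coinRunLaw_le (M : StochasticMethod.{u} d) {θ : ℝ} (hθ : |θ| ≤ 1) {t : ℝ} (ht : 0 < t)
    {n : ℕ} {G : Set (M.Seed × (ℕ → Bool))} (hGm : MeasurableSet G)
    (hG : ∀ ω, ∀ ξ ξ' : ℕ → Bool, (∀ i < n, ξ i = ξ' i) → (ω, ξ) ∈ G → (ω, ξ') ∈ G) :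
    M.coinRunLaw θ G ≤ ENNReal.ofReal ((1 + θ ^ 2) ^ n / (2 * t)) +
      ENNReal.ofReal (t / 2) * M.coinRunLaw 0 G := by
  have := isProbabilityMeasure_coinLaw hθ
  have := isProbabilityMeasure_coinLaw (θ := 0) (by simp)
  unfold coinRunLaw
  rw [Measure.prod_apply hGm, Measure.prod_apply hGm,
    ← lintegral_const_mul _ (measurable_measure_prodMk_left hGm)]
  refine (lintegral_mono fun ω =>
    infinitePi_coinLaw_le hθ ht (S := Prod.mk ω ⁻¹' G) (hG ω)).trans ?_
  rw [lintegral_add_left measurable_const, lintegral_const, measure_univ, mul_one]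

/-- An event that is likely under a coin of bias `θ` and is decided by the first `n` tosses is
not too unlikely under the fair coin. -/
theorem le_coinRunLaw_zero (M : StochasticMethod.{u} d) {θ : ℝ} (hθ : |θ| ≤ 1) {β : ℝ}
    (hβ : 0 < β) {n : ℕ} {G : Set (M.Seed × (ℕ → Bool))} (hGm : MeasurableSet G)
    (hG : ∀ ω, ∀ ξ ξ' : ℕ → Bool, (∀ i < n, ξ i = ξ' i) → (ω, ξ) ∈ G → (ω, ξ') ∈ G)
    (hβG : ENNReal.ofReal β ≤ M.coinRunLaw θ G) :
    β ^ 2 / Real.exp (n * θ ^ 2) ≤ (M.coinRunLaw 0).real G := by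
  have := M.isProbabilityMeasure_coinRunLaw (θ := 0) (by simp)
  have hA : (1 + θ ^ 2) ^ n ≤ Real.exp (n * θ ^ 2) := by
    rw [Real.exp_nat_mul]
    gcongr
    linarith [Real.add_one_le_exp (θ ^ 2)]
  set A := Real.exp (n * θ ^ 2) with hAdef
  have hA0 : 0 < A := Real.exp_pos _
  -- This `t` makes the second-moment term at most `β / 2`, leaving the other half of `β` for the
  -- fair coin.
  have h := hβG.trans (M.coinRunLaw_le hθ (t := A / β) (by positivity) hGm hG)
  rw [← ofReal_measureReal, ← ENNReal.ofReal_mul (by positivity),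
    ← ENNReal.ofReal_add (by positivity) (by positivity),
    ENNReal.ofReal_le_ofReal_iff (by positivity)] at h
  have h2 : (1 + θ ^ 2) ^ n / (2 * (A / β)) ≤ β / 2 := by
    rw [div_le_iff₀ (by positivity)]
    field_simp
    linarith
  rw [div_le_iff₀ hA0]
  have h3 : β / 2 ≤ A / β / 2 * (M.coinRunLaw 0).real G := by linarith
  have h4 : A / β / 2 * (M.coinRunLaw 0).real G = (M.coinRunLaw 0).real G * A / β / 2 := by ring
  rw [h4, div_le_div_iff_of_pos_right two_pos, le_div_iff₀ hβ] at h3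
  linarith [sq β]

end StochasticMethod

/-! ### The sequence of biases -/

open Filter Topology

/-- The bias used to defeat a method at time `128 ^ j`. -/
noncomputable def lilBias (j : ℕ) : ℝ := √(Real.log (j * Real.log 128) / 128 ^ j)

theorem four_lt_log : 4 < Real.log 128 := by
  have : (128 : ℝ) = 2 ^ 7 := by norm_num
  rw [this, Real.log_pow]
  have := Real.log_two_gt_d9
  norm_num
  linarith

theorem four_lt_mul_log {j : ℕ} (hj : 1 ≤ j) : 4 < j * Real.log 128 := by
  have h1 : (1 : ℝ) ≤ j := by exact_mod_cast hj
  nlinarith [four_lt_log]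

theorem log_mul_log_pos {j : ℕ} (hj : 1 ≤ j) : 0 < Real.log (j * Real.log 128) :=
  Real.log_pos (by linarith [four_lt_mul_log hj])

theorem lilBias_nonneg (j : ℕ) : 0 ≤ lilBias j := Real.sqrt_nonneg _

theorem lilBias_sq {j : ℕ} (hj : 1 ≤ j) :
    lilBias j ^ 2 = Real.log (j * Real.log 128) / 128 ^ j :=
  Real.sq_sqrt (div_nonneg (log_mul_log_pos hj).le (by positivity))

theorem lilBias_pos {j : ℕ} (hj : 1 ≤ j) : 0 < lilBias j :=
  Real.sqrt_pos.2 (div_pos (log_mul_log_pos hj) (by positivity))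

/-- The logarithm at most doubles while the denominator grows by 128, and `2 / 128 = (1 / 8) ^ 2`.
-/
theorem lilBias_succ_le {j : ℕ} (hj : 1 ≤ j) : lilBias (j + 1) ≤ lilBias j / 8 := by
  have h4 := four_lt_mul_log hj
  have h1 : (1 : ℝ) ≤ j := by exact_mod_cast hj
  have hlog : Real.log ((j + 1 : ℕ) * Real.log 128) ≤ 2 * Real.log (j * Real.log 128) := by
    have h2 : 2 * Real.log (j * Real.log 128) = Real.log ((j * Real.log 128) ^ 2) := by
      rw [Real.log_pow, Nat.cast_ofNat]
    rw [h2]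
    refine Real.log_le_log (mul_pos (by positivity) (by linarith [four_lt_log])) ?_
    push_cast
    nlinarith [four_lt_log]
  refine (sq_le_sq₀ (lilBias_nonneg _) (by linarith [lilBias_nonneg j])).1 ?_
  rw [div_pow, lilBias_sq hj, lilBias_sq (by omega), pow_succ]
  rw [div_le_iff₀ (by positivity)]
  have : Real.log (j * Real.log 128) / 128 ^ j / 8 ^ 2 * (128 ^ j * 128) =
      2 * Real.log (j * Real.log 128) := by
    field_simp
    ring
  rw [this]
  exact hlog

theorem lilBias_le_of_lt {i j : ℕ} (hi : 1 ≤ i) (hij : i < j) : lilBias j ≤ lilBias i / 8 := by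
  induction j, hij using Nat.le_induction with
  | base => exact lilBias_succ_le hi
  | succ j hij ih =>
    have := lilBias_succ_le (j := j) (by omega)
    linarith [lilBias_nonneg j]

theorem tendsto_lilBias : Tendsto lilBias atTop (𝓝 0) := by
  rw [← tendsto_add_atTop_iff_nat 1]
  have h : ∀ j, lilBias (j + 1) ≤ lilBias 1 * (1 / 8) ^ j := by
    intro j
    induction j with
    | zero => simp
    | succ j ih =>
      have := lilBias_succ_le (j := j + 1) (by omega)
      rw [pow_succ]
      linarith
  refine squeeze_zero (fun j => lilBias_nonneg _) h ?_
  simpa using (tendsto_pow_atTop_nhds_zero_of_lt_one (r := (1 / 8 : ℝ)) (by norm_num)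
    (by norm_num)).const_mul (lilBias 1)

/-- The cost of the change of measure at time `128 ^ j` is linear in `j`, hence the harmonic series.
-/
theorem exp_mul_lilBias_sq {j : ℕ} (hj : 1 ≤ j) :
    Real.exp (((128 ^ j : ℕ) : ℝ) * lilBias j ^ 2) = j * Real.log 128 := by
  rw [lilBias_sq hj, Nat.cast_pow, Nat.cast_ofNat, mul_div_cancel₀ _ (by positivity),
    Real.exp_log (by linarith [four_lt_mul_log hj])]

theorem not_forall_sum_le {a : ℝ} (ha : 0 < a) (j₀ : ℕ) (B : ℝ) :
    ¬ ∀ N : ℕ, ∑ j ∈ Finset.range N, a / ((j + j₀ : ℕ) * Real.log 128) ≤ B := by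
  intro h
  have hl : 0 < Real.log 128 := by linarith [four_lt_log]
  have hs := summable_of_sum_range_le (fun j => by positivity) h
  rw [summable_nat_add_iff (f := fun j : ℕ => a / ((j : ℝ) * Real.log 128)) j₀] at hs
  refine Real.not_summable_one_div_natCast ?_
  refine (hs.mul_left (Real.log 128 / a)).congr fun j => ?_
  rcases eq_or_ne (j : ℝ) 0 with hj | hj
  · simp [hj]
  · field_simp

/-! ### Separation of the problems and the lower bound -/

/-- Two quadratics whose minimizers are far apart have no common approximate minimizer. -/
theorem sq_dist_minimizers_le {d : ℕ} {μ r u v : ℝ} (hμ : 0 < μ) {c e x : Vec d} (he : ‖e‖ = 1)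
    (hu : quadratic μ (c + u • e) x ≤ r) (hv : quadratic μ (c + v • e) x ≤ r) :
    μ * (u - v) ^ 2 ≤ 8 * r := by
  have h1 : ‖(x - (c + v • e)) - (x - (c + u • e))‖ = |u - v| := by
    have : (x - (c + v • e)) - (x - (c + u • e)) = (u - v) • e := by module
    rw [this, norm_smul, he, mul_one, Real.norm_eq_abs]
  have h2 := norm_sub_le (x - (c + v • e)) (x - (c + u • e))
  rw [h1] at h2
  unfold quadratic at hu hv
  set y := ‖x - (c + u • e)‖
  set z := ‖x - (c + v • e)‖
  have h3 : (u - v) ^ 2 ≤ 2 * y ^ 2 + 2 * z ^ 2 := by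
    rw [← sq_abs (u - v)]
    nlinarith [abs_nonneg (u - v), sq_nonneg (y - z)]
  nlinarith

theorem theorem2 (α μ σ : ℝ) (hα₀ : 0 < α) (hα₁ : α < 1) (hμ : 0 < μ) (hσ : 0 < σ)
    (d : ℕ) (hd : 1 ≤ d) (L D : ℝ≥0∞) (hL : ENNReal.ofReal μ ≤ L) (hD : 0 < D) (c : Vec d)
    (M : StochasticMethod.{u} d) (ε : ℕ+ → ℝ≥0)
    (hM : HasUniformRate M (IsStronglyConvexProblemWithin μ σ L D c) ε α) :
    {n : ℕ+ | σ ^ 2 * (1 - α) / (48 * μ) * (Real.log (Real.log (n : ℝ)) / (n : ℝ))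
      ≤ (ε n : ℝ)}.Infinite := by
  by_contra hfin
  rw [Set.not_infinite] at hfin
  obtain ⟨N, hN⟩ := hfin.bddAbove
  obtain ⟨e, he⟩ : ∃ e : Vec d, ‖e‖ = 1 := ⟨EuclideanSpace.single ⟨0, hd⟩ 1, by simp⟩
  have hev : ∀ᶠ j : ℕ in atTop, 1 ≤ j ∧ (N : ℕ) ≤ j ∧ lilBias j ≤ 1 ∧
      ENNReal.ofReal (σ / 2 * |lilBias j| / μ) ≤ D := by
    have h1 := (tendsto_lilBias.eventually_lt_const one_pos).mono fun _ => le_of_lt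
    have h2 : Tendsto (fun j => ENNReal.ofReal (σ / 2 * |lilBias j| / μ)) atTop (𝓝 0) := by
      have := ENNReal.tendsto_ofReal ((tendsto_lilBias.abs.const_mul (σ / 2)).div_const μ)
      simpa using this
    have h3 := (h2.eventually_lt_const hD).mono fun _ => le_of_lt
    filter_upwards [eventually_ge_atTop 1, eventually_ge_atTop (N : ℕ), h1, h3] with j a b c e
      using ⟨a, b, c, e⟩
  obtain ⟨j₀, hj₀⟩ := eventually_atTop.1 hev
  have habs : ∀ j ≥ j₀, |lilBias j| ≤ 1 := fun j hj => by
    rw [abs_of_nonneg (lilBias_nonneg j)]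
    exact (hj₀ j hj).2.2.1
  have hj1 : ∀ j ≥ j₀, 1 ≤ j := fun j hj => (hj₀ j hj).1
  let n : ℕ → ℕ+ := fun j => 128 ^ j
  have hn : ∀ j, (n j : ℕ) = 128 ^ j := fun j => by simp [n]
  have hε : ∀ i ≥ j₀, (ε (n i) : ℝ) < σ ^ 2 / (48 * μ) * lilBias i ^ 2 := by
    intro i hi
    have h1 : N < n i := by
      rw [← PNat.coe_lt_coe, hn]
      exact (hj₀ i hi).2.1.trans_lt (Nat.lt_pow_self (by norm_num))
    have h2 : (ε (n i) : ℝ) < σ ^ 2 * (1 - α) / (48 * μ) *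
        (Real.log (Real.log (n i : ℝ)) / (n i : ℝ)) :=
      lt_of_not_ge fun h => (hN h).not_gt h1
    have h3 : Real.log (Real.log (n i : ℝ)) / (n i : ℝ) = lilBias i ^ 2 := by
      have : ((n i : ℕ) : ℝ) = 128 ^ i := by rw [hn]; simp
      rw [lilBias_sq (hj1 i hi), this, Real.log_pow]
    rw [h3] at h2
    -- The factor `1 - α ≤ 1` is given away.
    refine h2.trans_le ?_
    gcongr
    nlinarith [sq_nonneg σ]
  let x : ℕ → M.Seed × (ℕ → Bool) → Vec d := fun i p =>
    M.iterate (coinOracle μ (σ / 2) c e 0 (by simp)) p.1 p.2 (n i)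
  have hx : ∀ i, Measurable (x i) := fun i =>
    M.measurable_iterate (coinOracle μ (σ / 2) c e 0 (by simp)) (n i)
  let f : ℕ → Vec d → ℝ := fun j => quadratic μ (c + (σ / 2 * lilBias j / μ) • e)
  have hf : ∀ j, Measurable (f j) := fun j => by
    have : Continuous (f j) := by unfold f quadratic; fun_prop
    exact this.measurable
  -- Stopping at `i = j` makes `G j` depend on the first `128 ^ j` tosses only.
  let G : ℕ → Set (M.Seed × (ℕ → Bool)) := fun j =>
    {p | ∀ i ∈ Finset.Icc j₀ j, f j (x i p) ≤ ε (n i)}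
  have hGm : ∀ j, MeasurableSet (G j) := fun j => by
    have : G j = ⋂ i ∈ Finset.Icc j₀ j, {p | f j (x i p) ≤ ε (n i)} := by ext; simp [G]
    rw [this]
    exact Finset.measurableSet_biInter _ fun i _ =>
      measurableSet_le ((hf j).comp (hx i)) measurable_const
  have hGdep : ∀ j ω, ∀ ξ ξ' : ℕ → Bool, (∀ i < 128 ^ j, ξ i = ξ' i) →
      (ω, ξ) ∈ G j → (ω, ξ') ∈ G j := by
    intro j ω ξ ξ' h hG i hi
    have : x i (ω, ξ') = x i (ω, ξ) := by
      refine M.iterate_congr _ ω (n i) fun k hk => (h k (hk.trans_le ?_)).symm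
      rw [hn]
      exact Nat.pow_le_pow_right (by norm_num) (Finset.mem_Icc.1 hi).2
    rw [this]
    exact hG i hi
  have hβ : ∀ j ≥ j₀, ENNReal.ofReal (1 - α) ≤ M.coinRunLaw (lilBias j) (G j) := by
    intro j hj
    have hP := isStronglyConvexProblemWithin_quadratic hμ hσ (b := σ / 2) (by positivity)
      (habs j hj) (by linarith) hL c he (hj₀ j hj).2.2.2
    refine (hM _ _ hP).trans (measure_mono (μ := M.coinRunLaw (lilBias j)) fun p hp i _ => ?_)
    have h := hp (n i)
    rw [iInf_quadratic _ hμ.le, sub_zero] at h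
    have hit := M.iterate_coinOracle μ (σ / 2) c e (habs j hj) (θ' := 0) (by simp) p.1 p.2 (n i)
    simp only [f, x]
    rw [← hit]
    exact h
  have hdisj : ∀ i ≥ j₀, ∀ j, i < j → Disjoint (G i) (G j) := by
    intro i hi j hij
    rw [Set.disjoint_left]
    intro p hpi hpj
    -- The earlier index `i` is a time constrained by both events.
    have h := sq_dist_minimizers_le hμ he (hpi i (by simp [hi])) (hpj i (by simp [hi, hij.le]))
    have hlt := hε i hi
    have hle := lilBias_le_of_lt (hj1 i hi) hij
    have hi0 := lilBias_pos (hj1 i hi)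
    have hj0 := lilBias_nonneg j
    have h1 : μ * (σ / 2 * lilBias i / μ - σ / 2 * lilBias j / μ) ^ 2 =
        σ ^ 2 / (48 * μ) * (12 * (lilBias i - lilBias j) ^ 2) := by
      field_simp
      ring
    have h2 : (7 / 8 * lilBias i) ^ 2 ≤ (lilBias i - lilBias j) ^ 2 := by
      gcongr
      linarith
    have hC : 0 < σ ^ 2 / (48 * μ) := by positivity
    rw [h1] at h
    have h3 : σ ^ 2 / (48 * μ) * (12 * (lilBias i - lilBias j) ^ 2) <
        σ ^ 2 / (48 * μ) * (8 * lilBias i ^ 2) := by linarith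
    have h4 := lt_of_mul_lt_mul_left h3 hC.le
    -- Contradiction because `12 * (7 / 8) ^ 2 > 8`.
    nlinarith [pow_pos hi0 2]
  have := M.isProbabilityMeasure_coinRunLaw (θ := 0) (by simp)
  refine not_forall_sum_le (a := (1 - α) ^ 2) (pow_pos (by linarith) 2) j₀ 1 fun K => ?_
  calc ∑ j ∈ Finset.range K, (1 - α) ^ 2 / ((j + j₀ : ℕ) * Real.log 128)
      ≤ ∑ j ∈ Finset.range K, (M.coinRunLaw 0).real (G (j + j₀)) := by
        refine Finset.sum_le_sum fun j _ => ?_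
        have hj : j₀ ≤ j + j₀ := Nat.le_add_left _ _
        rw [← exp_mul_lilBias_sq (hj1 _ hj)]
        exact M.le_coinRunLaw_zero (habs _ hj) (by linarith) (hGm _) (hGdep _) (hβ _ hj)
    _ = (M.coinRunLaw 0).real (⋃ j ∈ Finset.range K, G (j + j₀)) := by
        refine (measureReal_biUnion_finset (fun i _ j _ hij => ?_) fun j _ => hGm _).symm
        rcases hij.lt_or_gt with h | h
        · exact hdisj _ (Nat.le_add_left _ _) _ (by omega)
        · exact (hdisj _ (Nat.le_add_left _ _) _ (by omega)).symm
    _ ≤ 1 := measureReal_le_one
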